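/- Let $\Omega=\{0,1\}^{\mathbb N}$ be the Cantor space and $\mathcal M(\Omega)$ the set of all (Borel) probability measures on $\Omega$. For a finite binary word $x$ let $x\Omega$ be the set of all sequences that begin with $x$, write $x\sqsubseteq\omega$ for $\omega\in x\Omega$, and write $P(x)$ for $P(x\Omega)$. A basic open set $\beta\subseteq\mathcal M(\Omega)$ is given by finitely many conditions $u<P(y)<v$ with binary words $y$ and rationals $u,v$. A function $t\colon\Omega\times\mathcal M(\Omega)\to[0,\infty]$ is lower semicomputable if there is an algorithm that, given a rational $r$, enumerates sets $x\Omega\times\beta$ with union $\{(\omega,P): r<t(\omega,P)\}$. A function $f\colon\{0,1\}^*\times\mathcal M(\Omega)\to[0,\infty]$ is lower semicomputable if there is an algorithm that, given a rational $r$ and a word $x$, enumerates basic open sets $\beta$ with union $\{P: r<f(x,P)\}$. A uniform test is a lower semicomputable $t\colon\Omega\times\mathcal M(\Omega)\to[0,\infty]$ with $\int t(\omega,P)\,dP(\omega)\le 1$ for every $P\in\mathcal M(\Omega)$. It is universal if for every uniform test $t'$ there is a constant $c$ with $t'(\omega,P)\le c\,t(\omega,P)$ for all $\omega,P$. A uniform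 lower semicomputable semimeasure is a lower semicomputable $f\colon\{0,1\}^*\times\mathcal M(\Omega)\to[0,\infty]$ with $\sum_x f(x,P)\le 1$ for every $P\in\mathcal M(\Omega)$. It is maximal if for every uniform lower semicomputable semimeasure $f'$ there is a constant $c$ with $f'(x,P)\le c\,f(x,P)$ for all $x,P$. Theorem. Let $\mathbf t(\omega,P)$ be any universal uniform test and $\mathbf m(x\mid P)$ any maximal uniform lower semicomputable semimeasure. Then $$\mathbf t(\omega,P)\stackrel{\cdot}{=}\sum_{x\sqsubseteq\omega}\frac{\mathbf m(x\mid P)}{P(x)},$$ that is, there are constants $c_1,c_2<\infty$, not depending on $\omega$ or $P$, such that for all $\omega\in\Omega$ and $P\in\mathcal M(\Omega)$ the left side is at most $c_1$ times the right side and the right side is at most $c_2$ times the left side. The sum is over all finite initial segments $x$ of $\omega$, including the empty word, and a term with $P(x)=0$ and $\mathbf m(x\mid P)>0$ is $\infty$. -/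

import Mathlib

open MeasureTheory
open scoped ENNReal NNReal

namespace CantorRandomness

/-- The binary Cantor space of infinite binary sequences, with its product topology and
product (equivalently, Borel) sigma-algebra. -/
abbrev Omega : Type := ℕ → Bool

/-- Finite binary words. -/
abbrev Word : Type := List Bool

/-- `IsInitial x ω`: the word `x` is an initial segment of the sequence `ω`. -/
def IsInitial (x : Word) (ω : Omega) : Prop :=
  ∀ (i : ℕ) (h : i < x.length), ω i = x[i]

/-- The interval `xΩ` of all sequences that begin with `x`. -/
def cyl (x : Word) : Set Omega := {ω | IsInitial x ω}

/-- A rational number as a finite object: a numerator `a` and a natural number `b`. -/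
abbrev RatCode : Type := ℤ × ℕ

/-- The rational number `a / (b + 1)` presented by the pair `(a, b)`. -/
def RatCode.val (q : RatCode) : ℚ := (q.1 : ℚ) / ((q.2 : ℚ) + 1)

/-- A basic open set in the space of measures as a finite object: a finite list of triples
`(y, u, v)`, each standing for the condition `u < P(y) < v`. -/
abbrev BoxCode : Type := List (Word × RatCode × RatCode)

/-- The set of probability measures satisfying all the conditions on the list. -/
def BoxCode.toSet (β : BoxCode) : Set (ProbabilityMeasure Omega) :=
  {P | ∀ e ∈ β, (e.2.1.val : ℝ) < (P : Measure Omega).real (cyl e.1) ∧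
    (P : Measure Omega).real (cyl e.1) < (e.2.2.val : ℝ)}

/-- `r < a`, for a rational `r` and `a ∈ [0, ∞]`. -/
def RatLT (r : ℚ) (a : ℝ≥0∞) : Prop := ((r : ℝ) : EReal) < (a : EReal)

/-- A function of a sequence and a measure is lower semicomputable if some algorithm, given a
rational `r`, enumerates basic open sets `xΩ × β` whose union is `{(ω, P) | r < t(ω, P)}`. -/
def LowerSemicomputable (t : Omega → ProbabilityMeasure Omega → ℝ≥0∞) : Prop :=
  ∃ A : RatCode × Word × BoxCode → Prop, REPred A ∧
    ∀ (r : RatCode) (ω : Omega) (P : ProbabilityMeasure Omega),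
      RatLT r.val (t ω P) ↔ ∃ (x : Word) (β : BoxCode), A (r, x, β) ∧ ω ∈ cyl x ∧ P ∈ β.toSet

/-- A function of a word and a measure is lower semicomputable if some algorithm, given a
rational `r` and a word `x`, enumerates basic open sets whose union is `{P | r < f(x, P)}`. -/
def LowerSemicomputableOnWords (f : Word → ProbabilityMeasure Omega → ℝ≥0∞) : Prop :=
  ∃ A : RatCode × Word × BoxCode → Prop, REPred A ∧
    ∀ (r : RatCode) (x : Word) (P : ProbabilityMeasure Omega),
      RatLT r.val (f x P) ↔ ∃ β : BoxCode, A (r, x, β) ∧ P ∈ β.toSet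

/-- Uniform tests. -/
structure IsUniformTest (t : Omega → ProbabilityMeasure Omega → ℝ≥0∞) : Prop where
  lowerSemicomputable : LowerSemicomputable t
  lintegral_le_one : ∀ P : ProbabilityMeasure Omega, ∫⁻ ω, t ω P ∂(P : Measure Omega) ≤ 1

/-- Universal uniform tests: those maximal up to a constant factor. -/
structure IsUniversalUniformTest (t : Omega → ProbabilityMeasure Omega → ℝ≥0∞) : Prop where
  isUniformTest : IsUniformTest t
  maximal : ∀ t' : Omega → ProbabilityMeasure Omega → ℝ≥0∞, IsUniformTest t' →
    ∃ c : ℝ≥0, ∀ ω P, t' ω P ≤ c * t ω P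

/-- Uniform lower semicomputable (discrete) semimeasures. -/
structure IsUniformSemimeasure (f : Word → ProbabilityMeasure Omega → ℝ≥0∞) : Prop where
  lowerSemicomputable : LowerSemicomputableOnWords f
  tsum_le_one : ∀ P : ProbabilityMeasure Omega, ∑' x : Word, f x P ≤ 1

/-- A priori probability with respect to a measure: a uniform lower semicomputable semimeasure
that is maximal up to a constant factor. -/
structure IsAprioriProbability (m : Word → ProbabilityMeasure Omega → ℝ≥0∞) : Prop where
  isUniformSemimeasure : IsUniformSemimeasure m
  maximal : ∀ f : Word → ProbabilityMeasure Omega → ℝ≥0∞, IsUniformSemimeasure f →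
    ∃ c : ℝ≥0, ∀ x P, f x P ≤ c * m x P

/-- The sum of `m(x | P) / P(x)` over all initial segments `x` of `ω`. Division is that of
`[0, ∞]`: a positive number divided by `0` is `∞`. -/
noncomputable def initialSum (m : Word → ProbabilityMeasure Omega → ℝ≥0∞)
    (ω : Omega) (P : ProbabilityMeasure Omega) : ℝ≥0∞ :=
  ∑' x : {x : Word // IsInitial x ω}, m x P / (P : Measure Omega) (cyl x)

/-- Equality up to a bounded factor of two functions of a sequence and a measure. -/
def EqUpToFactor (f g : Omega → ProbabilityMeasure Omega → ℝ≥0∞) : Prop :=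
  (∃ c : ℝ≥0, ∀ ω P, f ω P ≤ c * g ω P) ∧ (∃ c : ℝ≥0, ∀ ω P, g ω P ≤ c * f ω P)

end CantorRandomness

/-!
The integral of `∑_{x ⊑ ω} m(x | P) / P(x)` with respect to `P` is at most `∑_x m(x | P) ≤ 1`, and
the sum is lower semicomputable, being the supremum of its partial sums along `ω`. So it is a
uniform test, which gives one inequality.

Conversely, a lower semicomputable `t` is the supremum along the initial segments of `ω` of
functions `h(x, P)` that are computable (not just lower semicomputable) in `P` and increase with
`x`. Here the indicator function of a basic open set `β` enters as the limit of `min(1, n g)`,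
where the gauge `g(P)` is the least amount by which `P` satisfies the conditions defining `β`.
Computability of `h` makes the increment `d(x, P)` of `h` at the last letter of `x` lower
semicomputable, so that `P(x) d(x, P)` is a semimeasure: its sum is the integral of
`∑_{x ⊑ ω} d(x, P) = t(ω, P)`. By maximality `P(x) d(x, P) ≤ c m(x | P)`; dividing by `P(x)` and
summing gives the other inequality. Where `P(x) = 0` the division is harmless because `m` is
positive, as `2 ^ (-code(x) - 1)` is a semimeasure.
-/

namespace CantorRandomness

open Primrec (fst snd)

/-! ### Coded rational numbers -/

/-- A nonnegative rational number as a finite object: the pair `(a, b)` stands for `a / (b + 1)`,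
as in `RatCode`. Thresholds in `[0, ∞]` range over these codes, so that no case distinction on
signs is needed after the translation from `RatCode`. -/
abbrev NNRatCode : Type := ℕ × ℕ

namespace NNRatCode

/-- The number `a / (b + 1)` presented by the pair `(a, b)`. -/
noncomputable def val (q : NNRatCode) : ℝ≥0 := q.1 / (q.2 + 1)

/-- Addition of coded numbers. -/
def add (q s : NNRatCode) : NNRatCode :=
  (q.1 * (s.2 + 1) + s.1 * (q.2 + 1), q.2 * s.2 + q.2 + s.2)

/-- Multiplication of coded numbers. -/
def mul (q s : NNRatCode) : NNRatCode := (q.1 * s.1, q.2 * s.2 + q.2 + s.2)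

theorem val_add (q s : NNRatCode) : (q.add s).val = q.val + s.val := by
  simp only [val, add]
  push_cast
  field_simp
  ring

theorem val_mul (q s : NNRatCode) : (q.mul s).val = q.val * s.val := by
  simp only [val, mul]
  push_cast
  field_simp
  ring

theorem val_one_left (n : ℕ) : val (1, n) = (n + 1 : ℝ≥0)⁻¹ := by simp [val]

theorem val_zero_left (n : ℕ) : val (0, n) = 0 := by simp [val]

theorem val_lt_val {q s : NNRatCode} :
    q.val < s.val ↔ q.1 * (s.2 + 1) < s.1 * (q.2 + 1) := by
  rw [val, val, div_lt_div_iff₀ (by positivity) (by positivity)]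
  exact_mod_cast Iff.rfl

theorem primrec_denom_mul : Primrec₂ fun q s : NNRatCode => q.2 * s.2 + q.2 + s.2 :=
  have hq : Primrec fun p : NNRatCode × NNRatCode => p.1.2 := snd.comp fst
  have hs : Primrec fun p : NNRatCode × NNRatCode => p.2.2 := snd.comp snd
  Primrec.nat_add.comp (Primrec.nat_add.comp (Primrec.nat_mul.comp hq hs) hq) hs

theorem primrec_cross_mul : Primrec₂ fun q s : NNRatCode => q.1 * (s.2 + 1) :=
  Primrec.nat_mul.comp (fst.comp fst) (Primrec.succ.comp (snd.comp snd))

theorem primrec_add : Primrec₂ add :=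
  Primrec.pair (Primrec.nat_add.comp primrec_cross_mul primrec_cross_mul.swap) primrec_denom_mul

theorem primrec_mul : Primrec₂ mul :=
  Primrec.pair (Primrec.nat_mul.comp (fst.comp fst) (fst.comp snd)) primrec_denom_mul

theorem primrec_lt : PrimrecRel fun q s : NNRatCode => q.val < s.val :=
  (Primrec.nat_lt.comp primrec_cross_mul primrec_cross_mul.swap).of_eq fun _ => val_lt_val.symm

theorem exists_val_eq {r : ℚ} (hr : 0 ≤ r) : ∃ q : NNRatCode, q.val = Real.toNNReal r := by
  refine ⟨(r.num.toNat, r.den - 1), NNReal.coe_injective ?_⟩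
  have hnum : ((r.num.toNat : ℤ) : ℝ) = r.num := by
    rw [Int.toNat_of_nonneg (Rat.num_nonneg.2 hr)]
  have hden : ((r.den - 1 : ℕ) : ℝ) + 1 = r.den := by
    exact_mod_cast Nat.sub_add_cancel r.den_pos
  calc ((val (r.num.toNat, r.den - 1) : ℝ≥0) : ℝ)
      = (r.num.toNat : ℤ) / (((r.den - 1 : ℕ) : ℝ) + 1) := rfl
    _ = (Real.toNNReal r : ℝ) := by
      rw [hnum, hden, ← Rat.cast_def, Real.coe_toNNReal _ (by exact_mod_cast hr)]

theorem dense_range_val : Dense (Set.range fun q : NNRatCode => (q.val : ℝ≥0∞)) := by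
  refine dense_of_exists_between fun a b hab => ?_
  obtain ⟨r, hr, har, hrb⟩ := ENNReal.lt_iff_exists_rat_btwn.1 hab
  obtain ⟨q, hq⟩ := exists_val_eq hr
  exact ⟨q.val, ⟨q, rfl⟩, hq ▸ har, hq ▸ hrb⟩

theorem exists_val_between {a b : ℝ≥0∞} (h : a < b) :
    ∃ q : NNRatCode, a < q.val ∧ (q.val : ℝ≥0∞) < b := by
  obtain ⟨_, ⟨q, rfl⟩, haq, hqb⟩ := dense_range_val.exists_between h
  exact ⟨q, haq, hqb⟩

theorem val_le_of_eq_zero_or_lt {q : NNRatCode} {a : ℝ≥0∞}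
    (h : q.1 = 0 ∨ (q.val : ℝ≥0∞) < a) : (q.val : ℝ≥0∞) ≤ a :=
  h.elim (fun h0 => by simp [val, h0]) le_of_lt

theorem exists_seq_tendsto (a : ℝ≥0∞) : ∃ u : ℕ → NNRatCode,
    (∀ k, (u k).1 = 0 ∨ ((u k).val : ℝ≥0∞) < a) ∧
      Filter.Tendsto (fun k => ((u k).val : ℝ≥0∞)) Filter.atTop (nhds a) := by
  rcases eq_zero_or_pos a with rfl | ha
  · exact ⟨fun _ => (0, 0), by simp, by simp [val_zero_left]⟩
  · obtain ⟨v, -, hv, hlim⟩ := dense_range_val.exists_seq_strictMono_tendsto_of_lt ha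
    choose u hu using fun k => (hv k).2
    exact ⟨u, fun k => .inr ((hu k).trans_lt (hv k).1.2), by simpa only [hu] using hlim⟩

/-- The sum of a list of coded numbers. -/
def sum (l : List NNRatCode) : NNRatCode := l.foldr add (0, 0)

theorem val_sum (l : List NNRatCode) :
    ((sum l).val : ℝ≥0∞) = (l.map fun q => (q.val : ℝ≥0∞)).sum := by
  induction l with
  | nil => simp [sum, val_zero_left]
  | cons q l ih =>
    rw [sum, List.foldr_cons, val_add, ← sum, ENNReal.coe_add, ih, List.map_cons, List.sum_cons]

theorem primrec_sum : Primrec sum :=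
  Primrec.list_foldr Primrec.id (Primrec.const (0, 0))
    (primrec_add.comp₂ (fst.comp₂ Primrec₂.right) (snd.comp₂ Primrec₂.right))

end NNRatCode

namespace RatCode

/-- The positive part of a coded rational number. -/
def posPart (q : RatCode) : NNRatCode := (q.1.toNat, q.2)

theorem val_eq_posPart {q : RatCode} (hq : 0 ≤ q.1) : (q.val : ℝ) = q.posPart.val := by
  obtain ⟨n, hn⟩ := Int.eq_ofNat_of_zero_le hq
  simp [val, posPart, NNRatCode.val, hn]

theorem val_neg_iff {q : RatCode} : q.val < 0 ↔ q.1 < 0 := by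
  rw [val, div_lt_iff₀ (by positivity), zero_mul]
  exact_mod_cast Iff.rfl

theorem ratLT_val_iff {q : RatCode} {a : ℝ≥0∞} :
    RatLT q.val a ↔ q.1 < 0 ∨ (q.posPart.val : ℝ≥0∞) < a := by
  rcases lt_or_ge q.1 0 with hq | hq
  · have h : (((q.val : ℚ) : ℝ) : EReal) < 0 := by exact_mod_cast val_neg_iff.2 hq
    exact iff_of_true (h.trans_le (EReal.coe_ennreal_nonneg a)) (.inl hq)
  · have h : (((q.val : ℚ) : ℝ) : EReal) = ((q.posPart.val : ℝ≥0∞) : EReal) := by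
      rw [val_eq_posPart hq]
      rfl
    rw [RatLT, h, EReal.coe_ennreal_lt_coe_ennreal_iff, or_iff_right hq.not_gt]

theorem ratLT_val_natCast_iff {q : NNRatCode} {a : ℝ≥0∞} :
    RatLT (val (q.1, q.2)) a ↔ (q.val : ℝ≥0∞) < a :=
  ratLT_val_iff.trans (or_iff_right (Int.natCast_nonneg _).not_gt)

theorem posPart_le_of_ratLT {q : RatCode} {a : ℝ≥0∞} (h : RatLT q.val a) :
    (q.posPart.val : ℝ≥0∞) ≤ a := by
  refine NNRatCode.val_le_of_eq_zero_or_lt ((ratLT_val_iff.1 h).imp_left fun hq => ?_)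
  exact Int.toNat_of_nonpos hq.le

theorem val_lt_toReal_iff {q : RatCode} {a : ℝ≥0∞} (ha : a ≠ ∞) :
    (q.val : ℝ) < a.toReal ↔ q.1 < 0 ∨ (q.posPart.val : ℝ≥0∞) < a := by
  rcases lt_or_ge q.1 0 with hq | hq
  · have h : ((q.val : ℚ) : ℝ) < 0 := by exact_mod_cast val_neg_iff.2 hq
    exact iff_of_true (h.trans_le ENNReal.toReal_nonneg) (.inl hq)
  · lift a to ℝ≥0 using ha
    rw [val_eq_posPart hq, or_iff_right hq.not_gt, ENNReal.coe_toReal]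
    exact_mod_cast Iff.rfl

theorem toReal_lt_val_iff {q : RatCode} {a : ℝ≥0∞} (ha : a ≠ ∞) :
    a.toReal < (q.val : ℝ) ↔ a < (q.posPart.val : ℝ≥0∞) := by
  rcases lt_or_ge q.1 0 with hq | hq
  · have h : ((q.val : ℚ) : ℝ) < 0 := by exact_mod_cast val_neg_iff.2 hq
    have h0 : q.posPart.val = 0 := by simp [posPart, Int.toNat_of_nonpos hq.le, NNRatCode.val]
    exact iff_of_false (h.trans_le ENNReal.toReal_nonneg).not_gt (by simp [h0])
  · lift a to ℝ≥0 using ha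
    rw [val_eq_posPart hq, ENNReal.coe_toReal]
    exact_mod_cast Iff.rfl

end RatCode

/-! ### Primitive recursive functions and enumerable predicates -/

theorem encode_int_natCast (n : ℕ) : Encodable.encode (n : ℤ) = 2 * n := rfl

theorem encode_int_negSucc (n : ℕ) : Encodable.encode (Int.negSucc n) = 2 * n + 1 := rfl

theorem primrec_int_toNat : Primrec Int.toNat := by
  have h : Primrec fun z : ℤ => cond (Encodable.encode z).bodd 0 (Encodable.encode z).div2 :=
    Primrec.cond (Primrec.nat_bodd.comp Primrec.encode) (Primrec.const 0)
      (Primrec.nat_div2.comp Primrec.encode)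
  refine h.of_eq fun z => ?_
  rcases z with n | n
  · rw [Int.ofNat_eq_natCast, encode_int_natCast]
    simp [Nat.div2_val]
  · simp [encode_int_negSucc]

theorem RatCode.primrec_posPart : Primrec RatCode.posPart :=
  (primrec_int_toNat.comp fst).pair snd

theorem primrecPred_int_neg : PrimrecPred fun z : ℤ => z < 0 := by
  refine (Primrec.eq.comp (Primrec.nat_bodd.comp Primrec.encode) (Primrec.const true)).of_eq
    fun z => ?_
  rcases z with n | n
  · rw [Int.ofNat_eq_natCast, encode_int_natCast]
    simp
  · simp [encode_int_negSucc, Int.negSucc_lt_zero]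

theorem primrec_int_natCast : Primrec fun n : ℕ => (n : ℤ) :=
  Primrec.encode_iff.1 (Primrec.nat_double.of_eq fun n => (encode_int_natCast n).symm)

theorem rePred_comp {α β : Type*} [Primcodable α] [Primcodable β] {p : β → Prop} (hp : REPred p)
    {f : α → β} (hf : Computable f) : REPred fun a => p (f a) :=
  Partrec.comp hp hf

theorem rePred_iff_exists_primrec {α : Type*} [Primcodable α] {p : α → Prop} :
    REPred p ↔ ∃ g : α → ℕ → Bool, Primrec₂ g ∧ ∀ a, p a ↔ ∃ s, g a s = true := by
  constructor
  · intro hp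
    obtain ⟨c, hc⟩ := Nat.Partrec.Code.exists_code.1 hp
    refine ⟨fun a s => (c.evaln s (Encodable.encode a)).isSome, ?_, fun a => ?_⟩
    · exact Primrec.option_isSome.comp (Nat.Partrec.Code.primrec_evaln.comp
        (Primrec.pair (Primrec.pair snd (Primrec.const c)) (Primrec.encode.comp fst)))
    · have h : p a ↔ (c.eval (Encodable.encode a)).Dom := by
        rw [hc]
        simp [Encodable.encodek, Part.assert]
      rw [h, Part.dom_iff_mem]
      simp only [Nat.Partrec.Code.evaln_complete, Option.isSome_iff_exists, Option.mem_def]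
      exact exists_comm
  · rintro ⟨g, hg, hgp⟩
    have h : Partrec fun a => Nat.rfind fun s => Part.some (g a s) :=
      Partrec.rfind hg.to_comp.partrec₂
    refine h.dom_re.of_eq fun a => Iff.trans ?_ (hgp a).symm
    exact Nat.rfind_dom.trans ⟨fun ⟨s, hs, _⟩ => ⟨s, (Part.mem_some_iff.1 hs).symm⟩,
      fun ⟨s, hs⟩ => ⟨s, Part.mem_some_iff.2 hs.symm, fun _ => trivial⟩⟩

theorem exists_primrec_range_of_rePred {α : Type*} [Primcodable α] {p : α → Prop}
    (hp : REPred p) {a₀ : α} (ha₀ : p a₀) :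
    ∃ f : ℕ → α, Primrec f ∧ ∀ a, p a ↔ ∃ n, f n = a := by
  obtain ⟨g, hg, hgp⟩ := rePred_iff_exists_primrec.1 hp
  let f' (n : ℕ) (a : α) : α := if g a n.unpair.2 then a else a₀
  let f (n : ℕ) : α := ((Encodable.decode (α := α) n.unpair.1).map (f' n)).getD a₀
  refine ⟨f, ?_, fun a => ⟨fun ha => ?_, ?_⟩⟩
  · have hf' : Primrec₂ f' :=
      Primrec.ite (Primrec.eq.comp (hg.comp snd (snd.comp (Primrec.unpair.comp fst)))
        (Primrec.const true)) snd (Primrec.const a₀)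
    exact Primrec.option_getD.comp (Primrec.option_map
      (Primrec.decode.comp (fst.comp Primrec.unpair)) hf') (Primrec.const a₀)
  · obtain ⟨s, hs⟩ := (hgp a).1 ha
    exact ⟨Nat.pair (Encodable.encode a) s, by simp [f, f', hs]⟩
  · rintro ⟨n, rfl⟩
    rcases hd : Encodable.decode (α := α) n.unpair.1 with _ | a
    · simpa [f, hd] using ha₀
    · by_cases hs : g a n.unpair.2
      · simpa [f, f', hd, hs] using (hgp a).2 ⟨_, hs⟩
      · simpa [f, f', hd, hs] using ha₀

/-! ### Effectively open relations -/

/-- A relation between finite objects and measures is effectively open if the sets of measures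
it defines are unions of uniformly enumerated basic open sets. A primitive recursive enumeration
is demanded, which is no restriction: any enumeration can be slowed down to one. -/
def EffectivelyOpen {α : Type*} [Primcodable α] (R : α → ProbabilityMeasure Omega → Prop) :
    Prop :=
  ∃ G : α → ℕ → BoxCode, Primrec₂ G ∧ ∀ a P, R a P ↔ ∃ s, P ∈ (G a s).toSet

namespace BoxCode

/-- The contradictory condition `0 < P(Ω) < 0`, which stands for the empty set of measures. -/
def empty : BoxCode := [([], (0, 0), (0, 0))]

theorem mem_toSet_iff {β : BoxCode} {P : ProbabilityMeasure Omega} :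
    P ∈ β.toSet ↔ ∀ e ∈ β,
      (e.2.1.1 < 0 ∨ (e.2.1.posPart.val : ℝ≥0∞) < (P : Measure Omega) (cyl e.1)) ∧
        (P : Measure Omega) (cyl e.1) < (e.2.2.posPart.val : ℝ≥0∞) :=
  forall₂_congr fun _ _ => and_congr (RatCode.val_lt_toReal_iff (measure_ne_top _ _))
    (RatCode.toReal_lt_val_iff (measure_ne_top _ _))

theorem notMem_toSet_empty (P : ProbabilityMeasure Omega) : P ∉ empty.toSet := by
  simp [mem_toSet_iff, empty, RatCode.posPart, NNRatCode.val]

theorem mem_toSet_nil (P : ProbabilityMeasure Omega) : P ∈ toSet [] := by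
  simp [toSet]

theorem mem_toSet_append {P : ProbabilityMeasure Omega} {β γ : BoxCode} :
    P ∈ toSet (β ++ γ) ↔ P ∈ β.toSet ∧ P ∈ γ.toSet :=
  List.forall_mem_append

theorem mem_toSet_flatMap {ι : Type*} {P : ProbabilityMeasure Omega} {l : List ι}
    {f : ι → BoxCode} : P ∈ toSet (l.flatMap f) ↔ ∀ i ∈ l, P ∈ (f i).toSet := by
  simp only [toSet, Set.mem_ofPred_eq, List.mem_flatMap]
  exact ⟨fun h i hi e he => h e ⟨i, hi, he⟩, fun h e ⟨i, hi, he⟩ => h i hi e he⟩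

end BoxCode

section Closure

variable {α β : Type*} [Primcodable α] [Primcodable β]

theorem EffectivelyOpen.of_iff {R S : α → ProbabilityMeasure Omega → Prop} (hR : EffectivelyOpen R)
    (h : ∀ a P, S a P ↔ R a P) : EffectivelyOpen S :=
  funext₂ (fun a P => propext (h a P)) ▸ hR

theorem EffectivelyOpen.comp {R : α → ProbabilityMeasure Omega → Prop} (hR : EffectivelyOpen R)
    {f : β → α} (hf : Primrec f) : EffectivelyOpen fun b P => R (f b) P := by
  obtain ⟨G, hG, hGR⟩ := hR
  exact ⟨fun b => G (f b), hG.comp (hf.comp fst) snd, fun b P => hGR (f b) P⟩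

theorem EffectivelyOpen.mem_box {f : α → BoxCode} (hf : Primrec f) :
    EffectivelyOpen fun a P => P ∈ (f a).toSet :=
  ⟨fun a _ => f a, hf.comp fst, fun _ _ => (exists_const ℕ).symm⟩

theorem EffectivelyOpen.of_rePred {p : α → Prop} (hp : REPred p) :
    EffectivelyOpen fun a _ => p a := by
  obtain ⟨g, hg, hgp⟩ := rePred_iff_exists_primrec.1 hp
  refine ⟨fun a s => cond (g a s) [] BoxCode.empty,
    Primrec.cond hg (Primrec.const _) (Primrec.const _), fun a P => ?_⟩
  refine (hgp a).trans (exists_congr fun s => ?_)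
  cases hb : g a s <;> simp [hb, BoxCode.mem_toSet_nil, BoxCode.notMem_toSet_empty]

theorem EffectivelyOpen.of_primrecPred {p : α → Prop} (hp : PrimrecPred p) :
    EffectivelyOpen fun a _ => p a :=
  of_rePred (PrimrecPred.computablePred hp).to_re

theorem EffectivelyOpen.and {R S : α → ProbabilityMeasure Omega → Prop} (hR : EffectivelyOpen R)
    (hS : EffectivelyOpen S) : EffectivelyOpen fun a P => R a P ∧ S a P := by
  obtain ⟨G, hG, hGR⟩ := hR
  obtain ⟨H, hH, hHS⟩ := hS
  refine ⟨fun a s => G a s.unpair.1 ++ H a s.unpair.2, ?_, fun a P => ?_⟩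
  · exact Primrec.list_append.comp
      (hG.comp fst (fst.comp (Primrec.unpair.comp snd)))
      (hH.comp fst (snd.comp (Primrec.unpair.comp snd)))
  · simp only [hGR, hHS, BoxCode.mem_toSet_append]
    exact ⟨fun ⟨⟨s, hs⟩, ⟨u, hu⟩⟩ => ⟨Nat.pair s u, by simpa using ⟨hs, hu⟩⟩,
      fun ⟨s, hs, hu⟩ => ⟨⟨_, hs⟩, ⟨_, hu⟩⟩⟩

theorem EffectivelyOpen.exists {R : α → β → ProbabilityMeasure Omega → Prop}
    (hR : EffectivelyOpen fun (p : α × β) P => R p.1 p.2 P) :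
    EffectivelyOpen fun a P => ∃ b, R a b P := by
  obtain ⟨G, hG, hGR⟩ := hR
  refine ⟨fun a s => ((Encodable.decode (α := β) s.unpair.1).map
    fun b => G (a, b) s.unpair.2).getD BoxCode.empty, ?_, fun a P => ⟨?_, ?_⟩⟩
  · refine Primrec.option_getD.comp (Primrec.option_map
      (Primrec.decode.comp (fst.comp (Primrec.unpair.comp snd))) ?_) (Primrec.const _)
    exact hG.comp (Primrec.pair (fst.comp fst) snd)
      (snd.comp (Primrec.unpair.comp (snd.comp fst)))
  · rintro ⟨b, hb⟩
    obtain ⟨s, hs⟩ := (hGR (a, b) P).1 hb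
    exact ⟨Nat.pair (Encodable.encode b) s, by simpa using hs⟩
  · rintro ⟨s, hs⟩
    rcases hd : Encodable.decode (α := β) s.unpair.1 with _ | b
    · simp [hd, BoxCode.notMem_toSet_empty] at hs
    · exact ⟨b, (hGR (a, b) P).2 ⟨s.unpair.2, by simpa [hd] using hs⟩⟩

theorem EffectivelyOpen.or {R S : α → ProbabilityMeasure Omega → Prop} (hR : EffectivelyOpen R)
    (hS : EffectivelyOpen S) : EffectivelyOpen fun a P => R a P ∨ S a P := by
  have hT : EffectivelyOpen fun a P => ∃ b : Bool, if b then R a P else S a P := by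
    obtain ⟨G, hG, hGR⟩ := hR
    obtain ⟨H, hH, hHS⟩ := hS
    refine EffectivelyOpen.exists (R := fun a b P => if b then R a P else S a P)
      ⟨fun p s => cond p.2 (G p.1 s) (H p.1 s), ?_, ?_⟩
    · exact Primrec.cond (snd.comp fst) (hG.comp (fst.comp fst) snd) (hH.comp (fst.comp fst) snd)
    · rintro ⟨a, b⟩ P
      cases b <;> simp [hGR, hHS]
  exact hT.of_iff fun a P => by simp [or_comm]

theorem EffectivelyOpen.forall_mem {R : α → β → ProbabilityMeasure Omega → Prop} {l : α → List β}
    (hR : EffectivelyOpen fun (p : α × β) P => R p.1 p.2 P) (hl : Primrec l) :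
    EffectivelyOpen fun a P => ∀ b ∈ l a, R a b P := by
  obtain ⟨G, hG, hGR⟩ := hR
  have hbox : Primrec fun p : α × List (β × ℕ) => p.2.flatMap fun i => G (p.1, i.1) i.2 :=
    Primrec.list_flatMap snd
      (hG.comp (Primrec.pair (fst.comp fst) (fst.comp snd)) (snd.comp snd))
  have hfst : PrimrecPred fun p : α × List (β × ℕ) => p.2.map Prod.fst = l p.1 :=
    Primrec.eq.comp (Primrec.list_map snd (fst.comp snd)) (hl.comp fst)
  refine (EffectivelyOpen.exists (R := fun a (s : List (β × ℕ)) P => s.map Prod.fst = l a ∧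
    P ∈ BoxCode.toSet (s.flatMap fun i => G (a, i.1) i.2))
    ((EffectivelyOpen.of_primrecPred hfst).and (.mem_box hbox))).of_iff fun a P => ?_
  simp only [BoxCode.mem_toSet_flatMap]
  constructor
  · intro h
    choose! s hs using fun b hb => (hGR (a, b) P).1 (h b hb)
    refine ⟨(l a).map fun b => (b, s b), by simp [Function.comp_def], ?_⟩
    simpa using hs
  · rintro ⟨s, hsl, hs⟩ b hb
    obtain ⟨i, hi, rfl⟩ := List.mem_map.1 (hsl ▸ hb)
    exact (hGR (a, i.1) P).2 ⟨i.2, hs i hi⟩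

theorem EffectivelyOpen.exists_mem {R : α → β → ProbabilityMeasure Omega → Prop} {l : α → List β}
    (hR : EffectivelyOpen fun (p : α × β) P => R p.1 p.2 P) (hl : Primrec l) :
    EffectivelyOpen fun a P => ∃ b ∈ l a, R a b P :=
  have hmem : PrimrecPred fun p : α × β => p.2 ∈ l p.1 :=
    (Primrec.eq.exists_mem_list.comp (hl.comp fst) snd).of_eq fun p => by simp
  EffectivelyOpen.exists (R := fun a b P => b ∈ l a ∧ R a b P)
    ((EffectivelyOpen.of_primrecPred hmem).and hR)

theorem EffectivelyOpen.lt_measure_cyl :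
    EffectivelyOpen fun (p : NNRatCode × Word) P =>
      (p.1.val : ℝ≥0∞) < (P : Measure Omega) (cyl p.2) := by
  have hbox : Primrec fun p : NNRatCode × Word =>
      ([(p.2, ((p.1.1 : ℤ), p.1.2), (2, 0))] : BoxCode) :=
    Primrec.list_cons.comp (snd.pair (Primrec.pair
      (Primrec.pair (primrec_int_natCast.comp (fst.comp fst)) (snd.comp fst))
        (Primrec.const _))) (Primrec.const _)
  refine (mem_box hbox).of_iff fun p P => ?_
  have h2 : (P : Measure Omega) (cyl p.2) < 2 := prob_le_one.trans_lt ENNReal.one_lt_two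
  have hpos : ¬ (p.1.1 : ℤ) < 0 := by omega
  simp [BoxCode.mem_toSet_iff, RatCode.posPart, NNRatCode.val, hpos, h2]

theorem EffectivelyOpen.measure_cyl_lt :
    EffectivelyOpen fun (p : NNRatCode × Word) P =>
      (P : Measure Omega) (cyl p.2) < (p.1.val : ℝ≥0∞) := by
  have hbox : Primrec fun p : NNRatCode × Word =>
      ([(p.2, (-1, 0), ((p.1.1 : ℤ), p.1.2))] : BoxCode) :=
    Primrec.list_cons.comp (snd.pair (Primrec.pair (Primrec.const _)
      (Primrec.pair (primrec_int_natCast.comp (fst.comp fst)) (snd.comp fst))))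
      (Primrec.const _)
  refine (mem_box hbox).of_iff fun p P => ?_
  simp [BoxCode.mem_toSet_iff, RatCode.posPart]

theorem EffectivelyOpen.ite {p : α → Prop} [DecidablePred p]
    {R S : α → ProbabilityMeasure Omega → Prop} (hp : PrimrecPred p) (hR : EffectivelyOpen R)
    (hS : EffectivelyOpen S) : EffectivelyOpen fun a P => if p a then R a P else S a P := by
  refine (((of_primrecPred hp).and hR).or ((of_primrecPred hp.not).and hS)).of_iff fun a P => ?_
  by_cases h : p a <;> simp [h]

theorem effectivelyOpen_iff_exists_rePred {R : α → ProbabilityMeasure Omega → Prop} :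
    EffectivelyOpen R ↔ ∃ A : α × BoxCode → Prop, REPred A ∧
      ∀ a P, R a P ↔ ∃ β : BoxCode, A (a, β) ∧ P ∈ β.toSet := by
  constructor
  · rintro ⟨G, hG, hGR⟩
    have hA : PrimrecRel fun (p : α × BoxCode) s => G p.1 s = p.2 :=
      Primrec.eq.comp (hG.comp (fst.comp fst) snd) (snd.comp fst)
    refine ⟨fun p => ∃ s, G p.1 s = p.2, rePred_iff_exists_primrec.2
      ⟨_, hA.decide, fun _ => by simp⟩, fun a P => ?_⟩
    simp [hGR]
  · rintro ⟨A, hA, hAR⟩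
    exact (EffectivelyOpen.exists (R := fun a β P => A (a, β) ∧ P ∈ BoxCode.toSet β)
      ((EffectivelyOpen.of_rePred hA).and (.mem_box snd))).of_iff hAR

end Closure

/-! ### Semicomputable families of functions of a measure -/

section Families

variable {α β : Type*} [Primcodable α] [Primcodable β]

/-- A family of functions `𝓜(Ω) → [0, ∞]` indexed by finite objects is lower semicomputable if
the superlevel sets at nonnegative rational thresholds are uniformly effectively open. -/
def LowerSemicomputableFamily (F : α → ProbabilityMeasure Omega → ℝ≥0∞) : Prop :=
  EffectivelyOpen fun (p : NNRatCode × α) P => (p.1.val : ℝ≥0∞) < F p.2 P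

/-- A family of functions `𝓜(Ω) → [0, ∞]` indexed by finite objects is upper semicomputable if
the sublevel sets at nonnegative rational thresholds are uniformly effectively open. -/
def UpperSemicomputableFamily (F : α → ProbabilityMeasure Omega → ℝ≥0∞) : Prop :=
  EffectivelyOpen fun (p : NNRatCode × α) P => F p.2 P < (p.1.val : ℝ≥0∞)

/-- A family of functions of a measure that is both lower and upper semicomputable. Such functions
are continuous, and their differences are again lower semicomputable. -/
structure ComputableFamily (F : α → ProbabilityMeasure Omega → ℝ≥0∞) : Prop where
  lower : LowerSemicomputableFamily F
  upper : UpperSemicomputableFamily F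

theorem LowerSemicomputableFamily.lt {F : α → ProbabilityMeasure Omega → ℝ≥0∞}
    (hF : LowerSemicomputableFamily F) {r : β → NNRatCode} {f : β → α} (hr : Primrec r)
    (hf : Primrec f) : EffectivelyOpen fun b P => ((r b).val : ℝ≥0∞) < F (f b) P :=
  EffectivelyOpen.comp (f := fun b => (r b, f b)) hF (hr.pair hf)

theorem UpperSemicomputableFamily.lt {F : α → ProbabilityMeasure Omega → ℝ≥0∞}
    (hF : UpperSemicomputableFamily F) {r : β → NNRatCode} {f : β → α} (hr : Primrec r)
    (hf : Primrec f) : EffectivelyOpen fun b P => F (f b) P < ((r b).val : ℝ≥0∞) :=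
  EffectivelyOpen.comp (f := fun b => (r b, f b)) hF (hr.pair hf)

theorem LowerSemicomputableFamily.comp {F : α → ProbabilityMeasure Omega → ℝ≥0∞}
    (hF : LowerSemicomputableFamily F) {f : β → α} (hf : Primrec f) :
    LowerSemicomputableFamily fun b => F (f b) :=
  hF.lt fst (hf.comp snd)

theorem UpperSemicomputableFamily.comp {F : α → ProbabilityMeasure Omega → ℝ≥0∞}
    (hF : UpperSemicomputableFamily F) {f : β → α} (hf : Primrec f) :
    UpperSemicomputableFamily fun b => F (f b) :=
  hF.lt fst (hf.comp snd)

theorem ComputableFamily.comp {F : α → ProbabilityMeasure Omega → ℝ≥0∞}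
    (hF : ComputableFamily F) {f : β → α} (hf : Primrec f) :
    ComputableFamily fun b => F (f b) :=
  ⟨hF.lower.comp hf, hF.upper.comp hf⟩

theorem LowerSemicomputableFamily.mul {F G : α → ProbabilityMeasure Omega → ℝ≥0∞}
    (hF : LowerSemicomputableFamily F) (hG : LowerSemicomputableFamily G) :
    LowerSemicomputableFamily fun a P => F a P * G a P := by
  have hT : EffectivelyOpen fun (p : NNRatCode × α) P => ∃ u : NNRatCode × NNRatCode,
      p.1.val < (u.1.mul u.2).val ∧ (u.1.val : ℝ≥0∞) < F p.2 P ∧ (u.2.val : ℝ≥0∞) < G p.2 P :=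
    .exists <| .and (.of_primrecPred (NNRatCode.primrec_lt.comp (fst.comp fst)
        (NNRatCode.primrec_mul.comp (fst.comp snd) (snd.comp snd))))
      (.and (hF.lt (fst.comp snd) (snd.comp fst)) (hG.lt (snd.comp snd) (snd.comp fst)))
  refine hT.of_iff fun p P => ⟨fun h => ?_, ?_⟩
  · obtain ⟨a, ha, b, hb, hab⟩ : ∃ a < F p.2 P, ∃ b < G p.2 P, (p.1.val : ℝ≥0∞) < a * b := by
      contrapose! h
      exact ENNReal.mul_le_of_forall_lt h
    obtain ⟨u, hau, huF⟩ := NNRatCode.exists_val_between ha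
    obtain ⟨v, hbv, hvG⟩ := NNRatCode.exists_val_between hb
    have huv : (p.1.val : ℝ≥0∞) < u.val * v.val := hab.trans_le (by gcongr)
    exact ⟨(u, v), by rw [NNRatCode.val_mul]; exact_mod_cast huv, huF, hvG⟩
  · rintro ⟨u, hpu, huF, huG⟩
    calc (p.1.val : ℝ≥0∞) < (u.1.mul u.2).val := ENNReal.coe_lt_coe.2 hpu
      _ = u.1.val * u.2.val := by rw [NNRatCode.val_mul, ENNReal.coe_mul]
      _ ≤ F p.2 P * G p.2 P := by gcongr

theorem UpperSemicomputableFamily.inv {F : α → ProbabilityMeasure Omega → ℝ≥0∞}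
    (hF : UpperSemicomputableFamily F) :
    LowerSemicomputableFamily fun a P => (F a P)⁻¹ := by
  have hT : EffectivelyOpen fun (p : NNRatCode × α) P => ∃ u : NNRatCode,
      (p.1.mul u).val < NNRatCode.val (1, 0) ∧ F p.2 P < u.val :=
    .exists <| .and (.of_primrecPred (NNRatCode.primrec_lt.comp
        (NNRatCode.primrec_mul.comp (fst.comp fst) snd) (Primrec.const _)))
      (hF.lt snd (snd.comp fst))
  refine hT.of_iff fun p P => ?_
  have hinv (u : NNRatCode) :
      (p.1.mul u).val < NNRatCode.val (1, 0) ↔ (u.val : ℝ≥0∞) < (p.1.val : ℝ≥0∞)⁻¹ := by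
    rw [← one_div, ENNReal.lt_div_iff_mul_lt (.inr ENNReal.coe_ne_top) (.inl ENNReal.coe_ne_top),
      NNRatCode.val_mul, NNRatCode.val_one_left, mul_comm]
    norm_cast
    simp
  simp only [hinv]
  rw [ENNReal.lt_inv_iff_lt_inv]
  exact ⟨fun h => (NNRatCode.exists_val_between h).imp fun _ => And.symm,
    fun ⟨u, hup, huF⟩ => huF.trans hup⟩

theorem LowerSemicomputableFamily.div {F G : α → ProbabilityMeasure Omega → ℝ≥0∞}
    (hF : LowerSemicomputableFamily F) (hG : UpperSemicomputableFamily G) :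
    LowerSemicomputableFamily fun a P => F a P / G a P :=
  hF.mul hG.inv

theorem LowerSemicomputableFamily.sub {F G : α → ProbabilityMeasure Omega → ℝ≥0∞}
    (hF : LowerSemicomputableFamily F) (hG : UpperSemicomputableFamily G) :
    LowerSemicomputableFamily fun a P => F a P - G a P := by
  have hT : EffectivelyOpen fun (p : NNRatCode × α) P => ∃ u : NNRatCode,
      G p.2 P < u.val ∧ ((p.1.add u).val : ℝ≥0∞) < F p.2 P :=
    .exists <| .and (hG.lt snd (snd.comp fst))
      (hF.lt (NNRatCode.primrec_add.comp (fst.comp fst) snd) (snd.comp fst))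
  refine hT.of_iff fun p P => ?_
  simp only [NNRatCode.val_add, ENNReal.coe_add, ← lt_tsub_iff_left]
  rw [lt_tsub_comm]
  exact ⟨NNRatCode.exists_val_between, fun ⟨u, hGu, huF⟩ => hGu.trans huF⟩

theorem LowerSemicomputableFamily.eq_zero_or_lt {F : α → ProbabilityMeasure Omega → ℝ≥0∞}
    (hF : LowerSemicomputableFamily F) {r : β → NNRatCode} {f : β → α} (hr : Primrec r)
    (hf : Primrec f) :
    EffectivelyOpen fun b P => (r b).1 = 0 ∨ ((r b).val : ℝ≥0∞) < F (f b) P :=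
  .or (.of_primrecPred (Primrec.eq.comp (fst.comp hr) (Primrec.const 0))) (hF.lt hr hf)

theorem UpperSemicomputableFamily.sub {F G : α → ProbabilityMeasure Omega → ℝ≥0∞}
    (hF : UpperSemicomputableFamily F) (hG : LowerSemicomputableFamily G)
    (hGtop : ∀ a P, G a P ≠ ∞) : UpperSemicomputableFamily fun a P => F a P - G a P := by
  have hT : EffectivelyOpen fun (p : NNRatCode × α) P => NNRatCode.val (0, 0) < p.1.val ∧
      ∃ u : NNRatCode, (u.1 = 0 ∨ (u.val : ℝ≥0∞) < G p.2 P) ∧ F p.2 P < (p.1.add u).val :=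
    .and (.of_primrecPred (NNRatCode.primrec_lt.comp (Primrec.const _) fst)) <|
      .exists <| .and (hG.eq_zero_or_lt snd (snd.comp fst))
        (hF.lt (NNRatCode.primrec_add.comp (fst.comp fst) snd) (snd.comp fst))
  refine hT.of_iff fun p P => ?_
  simp only [NNRatCode.val_zero_left, NNRatCode.val_add, ENNReal.coe_add]
  constructor
  · intro h
    obtain ⟨u, hu, hlim⟩ := NNRatCode.exists_seq_tendsto (G p.2 P)
    have hFG : F p.2 P < p.1.val + G p.2 P :=
      lt_of_not_ge fun h' => h.not_ge (ENNReal.le_sub_of_add_le_right (hGtop _ _) h')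
    obtain ⟨k, hk⟩ := ((hlim.const_add _).eventually_const_lt hFG).exists
    exact ⟨ENNReal.coe_pos.1 h.bot_lt, u k, hu k, hk⟩
  · rintro ⟨h0, u, hu, hF⟩
    refine (tsub_le_tsub_left (NNRatCode.val_le_of_eq_zero_or_lt hu) _).trans_lt ?_
    rcases le_or_gt (u.val : ℝ≥0∞) (F p.2 P) with h | h
    · exact (ENNReal.sub_lt_iff_lt_right ENNReal.coe_ne_top h).2 hF
    · rw [tsub_eq_zero_of_le h.le]
      exact_mod_cast h0

theorem LowerSemicomputableFamily.sum {F : α → ℕ → ProbabilityMeasure Omega → ℝ≥0∞} {n : α → ℕ}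
    (hF : LowerSemicomputableFamily fun p : α × ℕ => F p.1 p.2) (hn : Primrec n) :
    LowerSemicomputableFamily fun a P => ∑ j ∈ Finset.range (n a), F a j P := by
  have hT : EffectivelyOpen fun (p : NNRatCode × α) P => ∃ l : List (ℕ × NNRatCode),
      (l.map Prod.fst = List.range (n p.2) ∧ p.1.val < (NNRatCode.sum (l.map Prod.snd)).val) ∧
        ∀ e ∈ l, e.2.1 = 0 ∨ (e.2.val : ℝ≥0∞) < F p.2 e.1 P := by
    refine .exists (.and (.of_primrecPred (.and ?_ ?_)) (.forall_mem ?_ snd))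
    · exact Primrec.eq.comp (Primrec.list_map snd (fst.comp snd))
        (Primrec.list_range.comp (hn.comp (snd.comp fst)))
    · exact NNRatCode.primrec_lt.comp (fst.comp fst)
        (NNRatCode.primrec_sum.comp (Primrec.list_map snd (snd.comp snd)))
    · exact hF.eq_zero_or_lt (snd.comp snd)
        ((snd.comp (fst.comp fst)).pair (fst.comp snd))
  refine hT.of_iff fun p P => ⟨fun h => ?_, ?_⟩
  · choose u hu hlim using fun j => NNRatCode.exists_seq_tendsto (F p.2 j P)
    obtain ⟨k, hk⟩ := ((tendsto_finsetSum (Finset.range (n p.2))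
      fun j _ => hlim j).eventually_const_lt h).exists
    refine ⟨(List.range (n p.2)).map fun j => (j, u j k), ⟨?_, ?_⟩, ?_⟩
    · simp [Function.comp_def]
    · rw [← ENNReal.coe_lt_coe, NNRatCode.val_sum, List.map_map, List.map_map]
      exact hk
    · simpa using fun j _ => hu j k
  · rintro ⟨l, ⟨hl, hp⟩, hlF⟩
    calc (p.1.val : ℝ≥0∞) < (NNRatCode.sum (l.map Prod.snd)).val := ENNReal.coe_lt_coe.2 hp
      _ = (l.map fun e => (e.2.val : ℝ≥0∞)).sum := by
        rw [NNRatCode.val_sum, List.map_map, Function.comp_def]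
      _ ≤ (l.map fun e => F p.2 e.1 P).sum :=
        List.sum_le_sum fun e he => NNRatCode.val_le_of_eq_zero_or_lt (hlF e he)
      _ = ((l.map Prod.fst).map fun j => F p.2 j P).sum := by rw [List.map_map, Function.comp_def]
      _ = ∑ j ∈ Finset.range (n p.2), F p.2 j P := by rw [hl]; rfl

theorem LowerSemicomputableFamily.ite {p : α → Prop} [DecidablePred p]
    {F G : α → ProbabilityMeasure Omega → ℝ≥0∞} (hp : PrimrecPred p)
    (hF : LowerSemicomputableFamily F) (hG : LowerSemicomputableFamily G) :
    LowerSemicomputableFamily fun a P => if p a then F a P else G a P :=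
  (EffectivelyOpen.ite (hp.comp snd) hF hG).of_iff fun a P => by
    by_cases h : p a.2 <;> simp [h]

theorem UpperSemicomputableFamily.ite {p : α → Prop} [DecidablePred p]
    {F G : α → ProbabilityMeasure Omega → ℝ≥0∞} (hp : PrimrecPred p)
    (hF : UpperSemicomputableFamily F) (hG : UpperSemicomputableFamily G) :
    UpperSemicomputableFamily fun a P => if p a then F a P else G a P :=
  (EffectivelyOpen.ite (hp.comp snd) hF hG).of_iff fun a P => by
    by_cases h : p a.2 <;> simp [h]

namespace ComputableFamily

theorem val_code {q : α → NNRatCode} (hq : Primrec q) :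
    ComputableFamily fun a _ => ((q a).val : ℝ≥0∞) where
  lower := (EffectivelyOpen.of_primrecPred (NNRatCode.primrec_lt.comp fst (hq.comp snd))).of_iff
    fun _ _ => ENNReal.coe_lt_coe
  upper := (EffectivelyOpen.of_primrecPred (NNRatCode.primrec_lt.comp (hq.comp snd) fst)).of_iff
    fun _ _ => ENNReal.coe_lt_coe

theorem zero : ComputableFamily fun (_ : α) _ => (0 : ℝ≥0∞) := by
  simpa only [NNRatCode.val_zero_left, ENNReal.coe_zero] using
    val_code (α := α) (Primrec.const (0, 0))

theorem measure_cyl : ComputableFamily fun x (P : ProbabilityMeasure Omega) =>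
    (P : Measure Omega) (cyl x) :=
  ⟨EffectivelyOpen.lt_measure_cyl, EffectivelyOpen.measure_cyl_lt⟩

theorem ite {p : α → Prop} [DecidablePred p] {F G : α → ProbabilityMeasure Omega → ℝ≥0∞}
    (hp : PrimrecPred p) (hF : ComputableFamily F) (hG : ComputableFamily G) :
    ComputableFamily fun a P => if p a then F a P else G a P :=
  ⟨hF.lower.ite hp hG.lower, hF.upper.ite hp hG.upper⟩

theorem sub {F G : α → ProbabilityMeasure Omega → ℝ≥0∞} (hF : ComputableFamily F)
    (hG : ComputableFamily G) (hGtop : ∀ a P, G a P ≠ ∞) :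
    ComputableFamily fun a P => F a P - G a P :=
  ⟨hF.lower.sub hG.upper, hF.upper.sub hG.lower hGtop⟩

theorem min {F G : α → ProbabilityMeasure Omega → ℝ≥0∞} (hF : ComputableFamily F)
    (hG : ComputableFamily G) : ComputableFamily fun a P => min (F a P) (G a P) where
  lower := (hF.lower.and hG.lower).of_iff fun _ _ => lt_min_iff
  upper := (hF.upper.or hG.upper).of_iff fun _ _ => min_lt_iff

theorem natCast_add_one_mul {F : α → ProbabilityMeasure Omega → ℝ≥0∞} (hF : ComputableFamily F)
    {n : α → ℕ} (hn : Primrec n) : ComputableFamily fun a P => (n a + 1) * F a P := by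
  have hq : Primrec fun p : NNRatCode × α => p.1.mul (1, n p.2) :=
    NNRatCode.primrec_mul.comp fst ((Primrec.const 1).pair (hn.comp snd))
  have hval (p : NNRatCode × α) :
      ((p.1.mul (1, n p.2)).val : ℝ≥0∞) = p.1.val / (n p.2 + 1) := by
    rw [NNRatCode.val_mul, NNRatCode.val_one_left, div_eq_mul_inv, ENNReal.coe_mul,
      ENNReal.coe_inv (by positivity), ENNReal.coe_add, ENNReal.coe_natCast, ENNReal.coe_one]
  refine ⟨(hF.lower.lt hq snd).of_iff fun p P => ?_, (hF.upper.lt hq snd).of_iff fun p P => ?_⟩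
  · rw [hval, ENNReal.div_lt_iff (.inl (by simp)) (.inl (by finiteness)), mul_comm]
  · rw [hval, ENNReal.lt_div_iff_mul_lt (.inl (by simp)) (.inl (by finiteness)), mul_comm]

theorem finset_sup [DecidableEq β] {F : α → β → ProbabilityMeasure Omega → ℝ≥0∞} {l : α → List β}
    (hF : ComputableFamily fun p : α × β => F p.1 p.2) (hl : Primrec l) :
    ComputableFamily fun a P => (l a).toFinset.sup fun b => F a b P where
  lower := by
    have hT : EffectivelyOpen fun (p : NNRatCode × α) P =>
        ∃ b ∈ l p.2, (p.1.val : ℝ≥0∞) < F p.2 b P :=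
      .exists_mem (hF.lower.lt (fst.comp fst) ((snd.comp fst).pair snd)) (hl.comp snd)
    exact hT.of_iff fun p P => by simp [Finset.lt_sup_iff]
  upper := by
    have hT : EffectivelyOpen fun (p : NNRatCode × α) P =>
        NNRatCode.val (0, 0) < p.1.val ∧ ∀ b ∈ l p.2, F p.2 b P < (p.1.val : ℝ≥0∞) :=
      .and (.of_primrecPred (NNRatCode.primrec_lt.comp (Primrec.const _) fst))
        (.forall_mem (hF.upper.lt (fst.comp fst) ((snd.comp fst).pair snd)) (hl.comp snd))
    refine hT.of_iff fun p P => ?_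
    rw [NNRatCode.val_zero_left, ← ENNReal.coe_pos]
    exact ⟨fun h => ⟨h.bot_lt, by simpa [Finset.sup_lt_iff h.bot_lt] using h⟩,
      fun ⟨h0, h⟩ => by simpa [Finset.sup_lt_iff h0] using h⟩

theorem finset_inf [DecidableEq β] {F : α → β → ProbabilityMeasure Omega → ℝ≥0∞} {l : α → List β}
    (hF : ComputableFamily fun p : α × β => F p.1 p.2) (hl : Primrec l) :
    ComputableFamily fun a P => (l a).toFinset.inf fun b => F a b P where
  lower := by
    have hT : EffectivelyOpen fun (p : NNRatCode × α) P =>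
        ∀ b ∈ l p.2, (p.1.val : ℝ≥0∞) < F p.2 b P :=
      .forall_mem (hF.lower.lt (fst.comp fst) ((snd.comp fst).pair snd)) (hl.comp snd)
    exact hT.of_iff fun p P => by simp [Finset.lt_inf_iff]
  upper := by
    have hT : EffectivelyOpen fun (p : NNRatCode × α) P =>
        ∃ b ∈ l p.2, F p.2 b P < (p.1.val : ℝ≥0∞) :=
      .exists_mem (hF.upper.lt (fst.comp fst) ((snd.comp fst).pair snd)) (hl.comp snd)
    exact hT.of_iff fun p P => by simp [Finset.inf_lt_iff]

end ComputableFamily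

theorem lowerSemicomputableFamily_iff_ratLT {F : α → ProbabilityMeasure Omega → ℝ≥0∞} :
    LowerSemicomputableFamily F ↔
      EffectivelyOpen fun (p : RatCode × α) P => RatLT p.1.val (F p.2 P) := by
  constructor
  · intro hF
    exact ((EffectivelyOpen.of_primrecPred (primrecPred_int_neg.comp (fst.comp fst))).or
      (hF.lt (RatCode.primrec_posPart.comp fst) snd)).of_iff fun _ _ => RatCode.ratLT_val_iff
  · intro hF
    have hcode : Primrec fun p : NNRatCode × α => (((p.1.1 : ℤ), p.1.2), p.2) :=
      ((primrec_int_natCast.comp (fst.comp fst)).pair (snd.comp fst)).pair snd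
    exact (hF.comp hcode).of_iff fun p P => (RatCode.ratLT_val_natCast_iff (q := p.1)).symm

end Families

theorem lowerSemicomputableOnWords_iff
    {F : Word → ProbabilityMeasure Omega → ℝ≥0∞} :
    LowerSemicomputableOnWords F ↔ LowerSemicomputableFamily F := by
  rw [lowerSemicomputableFamily_iff_ratLT, effectivelyOpen_iff_exists_rePred]
  constructor
  · rintro ⟨A, hA, hAF⟩
    exact ⟨fun p => A (p.1.1, p.1.2, p.2), rePred_comp hA
      ((fst.comp fst).pair ((snd.comp fst).pair snd)).to_comp, fun p => hAF p.1 p.2⟩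
  · rintro ⟨A, hA, hAF⟩
    exact ⟨fun p => A ((p.1, p.2.1), p.2.2), rePred_comp hA
      ((fst.pair (fst.comp snd)).pair (snd.comp snd)).to_comp, fun r x => hAF (r, x)⟩

/-! ### Initial segments and cylinders -/

/-- The initial segment of length `n` of a sequence. -/
def initialWord (ω : Omega) (n : ℕ) : Word := (List.range n).map ω

@[simp] theorem length_initialWord (ω : Omega) (n : ℕ) : (initialWord ω n).length = n := by
  simp [initialWord]

theorem isInitial_initialWord (ω : Omega) (n : ℕ) : IsInitial (initialWord ω n) ω := by
  intro i h
  simp [initialWord]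

theorem initialWord_length {x : Word} {ω : Omega} (h : IsInitial x ω) :
    initialWord ω x.length = x := by
  refine List.ext_getElem (by simp) fun i h1 h2 => ?_
  simp [initialWord, h i h2]

theorem take_initialWord (ω : Omega) {j n : ℕ} (h : j ≤ n) :
    (initialWord ω n).take j = initialWord ω j := by
  rw [initialWord, ← List.map_take, List.take_range, min_eq_left h, initialWord]

theorem isPrefix_initialWord_iff {x : Word} {ω : Omega} {n : ℕ} :
    x <+: initialWord ω n ↔ x.length ≤ n ∧ IsInitial x ω := by
  rw [List.prefix_iff_eq_take]
  constructor
  · intro h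
    have hl : x.length ≤ n := by
      rw [h, List.length_take, length_initialWord]
      exact min_le_right _ _
    rw [take_initialWord ω hl] at h
    exact ⟨hl, h ▸ isInitial_initialWord ω _⟩
  · rintro ⟨hl, h⟩
    rw [take_initialWord ω hl, initialWord_length h]

theorem dropLast_initialWord_succ (ω : Omega) (n : ℕ) :
    (initialWord ω (n + 1)).dropLast = initialWord ω n := by
  rw [List.dropLast_eq_take, length_initialWord, add_tsub_cancel_right,
    take_initialWord ω n.le_succ]

/-- The initial segments of a sequence correspond to their lengths. -/
def initialEquiv (ω : Omega) : ℕ ≃ {x : Word // IsInitial x ω} where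
  toFun n := ⟨initialWord ω n, isInitial_initialWord ω n⟩
  invFun x := x.1.length
  left_inv n := by simp
  right_inv x := Subtype.ext (initialWord_length x.2)

theorem tsum_isInitial (ω : Omega) (g : Word → ℝ≥0∞) :
    ∑' x : {x : Word // IsInitial x ω}, g x = ∑' n, g (initialWord ω n) :=
  ((initialEquiv ω).tsum_eq fun x : {x : Word // IsInitial x ω} => g x).symm

theorem measurableSet_cyl (x : Word) : MeasurableSet (cyl x) := by
  have hcyl : cyl x = ⋂ (i : ℕ) (h : i < x.length), (fun ω : Omega => ω i) ⁻¹' {x[i]} := by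
    ext ω
    simp [cyl, IsInitial]
  rw [hcyl]
  exact MeasurableSet.iInter fun i => MeasurableSet.iInter fun h =>
    measurable_pi_apply i (measurableSet_singleton _)

theorem lintegral_tsum_isInitial (μ : Measure Omega) (g : Word → ℝ≥0∞) :
    ∫⁻ ω, ∑' x : {x : Word // IsInitial x ω}, g x ∂μ = ∑' x, g x * μ (cyl x) := by
  have h (ω : Omega) : ∑' x : {x : Word // IsInitial x ω}, g x =
      ∑' x, (cyl x).indicator (fun _ => g x) ω :=
    tsum_subtype {x : Word | IsInitial x ω} g
  simp only [h]
  rw [lintegral_tsum fun x => (measurable_const.indicator (measurableSet_cyl x)).aemeasurable]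
  exact tsum_congr fun x => lintegral_indicator_const (measurableSet_cyl x) _

/-! ### The sum over initial segments is a uniform test -/

theorem LowerSemicomputableFamily.lowerSemicomputable_iSup
    {F : Word → ProbabilityMeasure Omega → ℝ≥0∞} (hF : LowerSemicomputableFamily F) :
    LowerSemicomputable fun ω P => ⨆ n, F (initialWord ω n) P := by
  obtain ⟨A, hA, hAF⟩ := lowerSemicomputableOnWords_iff.2 hF
  refine ⟨A, hA, fun r ω P => ?_⟩
  calc RatLT r.val (⨆ n, F (initialWord ω n) P)
      ↔ ∃ n, RatLT r.val (F (initialWord ω n) P) := by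
        simp only [RatCode.ratLT_val_iff, lt_iSup_iff, exists_or, exists_const]
    _ ↔ ∃ x, ω ∈ cyl x ∧ RatLT r.val (F x P) :=
        ⟨fun ⟨n, h⟩ => ⟨_, isInitial_initialWord ω n, h⟩,
          fun ⟨x, hx, h⟩ => ⟨x.length, by rwa [initialWord_length hx]⟩⟩
    _ ↔ ∃ x β, A (r, x, β) ∧ ω ∈ cyl x ∧ P ∈ β.toSet := by
        simp only [hAF, ← exists_and_left, and_left_comm]

/-- The sum of `F y P` over all prefixes `y` of a word, including the word itself. -/
noncomputable def prefixSum (F : Word → ProbabilityMeasure Omega → ℝ≥0∞) (x : Word)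
    (P : ProbabilityMeasure Omega) : ℝ≥0∞ :=
  ∑ j ∈ Finset.range (x.length + 1), F (x.take j) P

theorem prefixSum_initialWord (F : Word → ProbabilityMeasure Omega → ℝ≥0∞) (ω : Omega) (n : ℕ)
    (P : ProbabilityMeasure Omega) :
    prefixSum F (initialWord ω n) P = ∑ j ∈ Finset.range (n + 1), F (initialWord ω j) P := by
  rw [prefixSum, length_initialWord]
  refine Finset.sum_congr rfl fun j hj => ?_
  rw [take_initialWord ω (Finset.mem_range_succ_iff.1 hj)]

theorem iSup_prefixSum (F : Word → ProbabilityMeasure Omega → ℝ≥0∞) (ω : Omega)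
    (P : ProbabilityMeasure Omega) :
    ⨆ n, prefixSum F (initialWord ω n) P = ∑' n, F (initialWord ω n) P := by
  simp only [prefixSum_initialWord]
  exact (ENNReal.tsum_eq_iSup_nat' (Filter.tendsto_add_atTop_nat 1)).symm

theorem LowerSemicomputableFamily.prefixSum {F : Word → ProbabilityMeasure Omega → ℝ≥0∞}
    (hF : LowerSemicomputableFamily F) : LowerSemicomputableFamily (prefixSum F) :=
  LowerSemicomputableFamily.sum (hF.comp (Primrec.list_take.comp snd fst))
    (Primrec.succ.comp Primrec.list_length)

theorem initialSum_eq_tsum (m : Word → ProbabilityMeasure Omega → ℝ≥0∞) (ω : Omega)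
    (P : ProbabilityMeasure Omega) :
    initialSum m ω P =
      ∑' n, m (initialWord ω n) P / (P : Measure Omega) (cyl (initialWord ω n)) :=
  tsum_isInitial ω fun x => m x P / (P : Measure Omega) (cyl x)

theorem IsUniformSemimeasure.isUniformTest_initialSum
    {m : Word → ProbabilityMeasure Omega → ℝ≥0∞} (hm : IsUniformSemimeasure m) :
    IsUniformTest (initialSum m) where
  lowerSemicomputable := by
    have hquot : LowerSemicomputableFamily fun x (P : ProbabilityMeasure Omega) =>
        m x P / (P : Measure Omega) (cyl x) :=
      (lowerSemicomputableOnWords_iff.1 hm.lowerSemicomputable).div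
        ComputableFamily.measure_cyl.upper
    have hsum : initialSum m = fun ω P => ⨆ n, prefixSum
        (fun x P => m x P / (P : Measure Omega) (cyl x)) (initialWord ω n) P :=
      funext₂ fun ω P => (initialSum_eq_tsum m ω P).trans
        (iSup_prefixSum (fun x P => m x P / (P : Measure Omega) (cyl x)) ω P).symm
    exact hsum ▸ hquot.prefixSum.lowerSemicomputable_iSup
  lintegral_le_one P :=
    calc ∫⁻ ω, initialSum m ω P ∂(P : Measure Omega)
        = ∑' x, m x P / (P : Measure Omega) (cyl x) * (P : Measure Omega) (cyl x) :=
          lintegral_tsum_isInitial _ fun x => m x P / (P : Measure Omega) (cyl x)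
      _ ≤ ∑' x, m x P := ENNReal.tsum_le_tsum fun x => by
          rw [mul_comm]
          exact ENNReal.mul_div_le
      _ ≤ 1 := hm.tsum_le_one P

/-! ### Basic open sets as limits of computable functions -/

/-- The amount by which a measure satisfies the condition `u < P(y) < v`, and `0` if it does not.
A negative bound `u` is no condition and is not taken into account. -/
noncomputable def slack (e : Word × RatCode × RatCode) (P : ProbabilityMeasure Omega) : ℝ≥0∞ :=
  if e.2.1.1 < 0 then e.2.2.posPart.val - (P : Measure Omega) (cyl e.1)
  else min ((P : Measure Omega) (cyl e.1) - e.2.1.posPart.val)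
    (e.2.2.posPart.val - (P : Measure Omega) (cyl e.1))

/-- The least slack of the conditions that define a basic open set: a computable function of the
measure that is positive exactly on that set. -/
noncomputable def BoxCode.gauge (β : BoxCode) (P : ProbabilityMeasure Omega) : ℝ≥0∞ :=
  β.toFinset.inf fun e => slack e P

theorem slack_pos_iff {e : Word × RatCode × RatCode} {P : ProbabilityMeasure Omega} :
    0 < slack e P ↔
      (e.2.1.1 < 0 ∨ (e.2.1.posPart.val : ℝ≥0∞) < (P : Measure Omega) (cyl e.1)) ∧
        (P : Measure Omega) (cyl e.1) < (e.2.2.posPart.val : ℝ≥0∞) := by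
  by_cases h : e.2.1.1 < 0 <;> simp [slack, h]

theorem BoxCode.gauge_pos_iff {β : BoxCode} {P : ProbabilityMeasure Omega} :
    0 < β.gauge P ↔ P ∈ β.toSet := by
  simp only [gauge, mem_toSet_iff, Finset.lt_inf_iff ENNReal.zero_lt_top, List.mem_toFinset,
    slack_pos_iff]

theorem computableFamily_slack : ComputableFamily slack := by
  have hneg : PrimrecPred fun e : Word × RatCode × RatCode => e.2.1.1 < 0 :=
    primrecPred_int_neg.comp (fst.comp (fst.comp snd))
  have hcyl : ComputableFamily fun (e : Word × RatCode × RatCode) (P : ProbabilityMeasure Omega) =>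
      (P : Measure Omega) (cyl e.1) := ComputableFamily.measure_cyl.comp fst
  have hlower : ComputableFamily fun (e : Word × RatCode × RatCode)
      (_ : ProbabilityMeasure Omega) => (e.2.1.posPart.val : ℝ≥0∞) :=
    .val_code (RatCode.primrec_posPart.comp (fst.comp snd))
  have hupper : ComputableFamily fun (e : Word × RatCode × RatCode)
      (P : ProbabilityMeasure Omega) =>
      e.2.2.posPart.val - (P : Measure Omega) (cyl e.1) :=
    (ComputableFamily.val_code (RatCode.primrec_posPart.comp (snd.comp snd))).sub hcyl
      fun _ _ => measure_ne_top _ _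
  exact .ite hneg hupper ((hcyl.sub hlower fun _ _ => ENNReal.coe_ne_top).min hupper)

theorem BoxCode.computableFamily_gauge : ComputableFamily BoxCode.gauge :=
  .finset_inf (F := fun _ => slack) (computableFamily_slack.comp snd) Primrec.id

/-! ### Approximation of a lower semicomputable function along initial segments -/

/-- `E` lists the triples `(r, x, β)` that witness the lower semicomputability of `t`: the sets
`xΩ × β` listed with a rational `r` have union `{(ω, P) | r < t(ω, P)}`. -/
def Enumerates (E : ℕ → RatCode × Word × BoxCode)
    (t : Omega → ProbabilityMeasure Omega → ℝ≥0∞) : Prop :=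
  ∀ r ω P, RatLT (RatCode.val r) (t ω P) ↔
    ∃ i, (E i).1 = r ∧ ω ∈ cyl (E i).2.1 ∧ P ∈ (E i).2.2.toSet

theorem LowerSemicomputable.exists_enumerates {t : Omega → ProbabilityMeasure Omega → ℝ≥0∞}
    (ht : LowerSemicomputable t) : ∃ E, Primrec E ∧ Enumerates E t := by
  obtain ⟨A, hA, hAt⟩ := ht
  obtain ⟨x, β, hne, -⟩ :=
    (hAt (-1, 0) default default).1 (RatCode.ratLT_val_iff.2 (.inl neg_one_lt_zero))
  obtain ⟨E, hE, hAE⟩ := exists_primrec_range_of_rePred hA hne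
  refine ⟨E, hE, fun r ω P => (hAt r ω P).trans ⟨?_, ?_⟩⟩
  · rintro ⟨x, β, hβ, h⟩
    obtain ⟨i, hi⟩ := (hAE _).1 hβ
    exact ⟨i, by simpa only [hi, true_and] using h⟩
  · rintro ⟨i, rfl, h⟩
    exact ⟨_, _, (hAE _).2 ⟨i, rfl⟩, h⟩

/-- The function `t` is the supremum along initial segments of the computable functions `h x`,
which increase with the word `x`, starting from `0`. -/
structure IsApproximation (h : Word → ProbabilityMeasure Omega → ℝ≥0∞)
    (t : Omega → ProbabilityMeasure Omega → ℝ≥0∞) : Prop where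
  computable : ComputableFamily h
  nil : ∀ P, h [] P = 0
  mono : ∀ {x y} P, x <+: y → h x P ≤ h y P
  iSup_eq : ∀ ω P, ⨆ n, h (initialWord ω n) P = t ω P

/-- The lower bound for `t(ω, P)`, where `ω` begins with `y`, that is known from the first `|y|`
sets of an enumeration. To be continuous in `P`, the value `r` is attained on `β` only in the
limit of large `|y|`. -/
noncomputable def approx (E : ℕ → RatCode × Word × BoxCode) (y : Word)
    (P : ProbabilityMeasure Omega) : ℝ≥0∞ :=
  (List.range y.length).toFinset.sup fun i =>
    if (E i).2.1 <+: y then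
      min ((E i).1.posPart.val : ℝ≥0∞) ((y.length + 1) * (E i).2.2.gauge P)
    else 0

section Approx

variable {E : ℕ → RatCode × Word × BoxCode} {t : Omega → ProbabilityMeasure Omega → ℝ≥0∞}

theorem primrec_isPrefix : PrimrecRel fun x y : Word => x <+: y :=
  (Primrec.eq.comp fst (Primrec.list_take.comp (Primrec.list_length.comp fst) snd)).of_eq
    fun _ => List.prefix_iff_eq_take.symm

theorem computableFamily_approx (hE : Primrec E) : ComputableFamily (approx E) := by
  have hentry : Primrec fun p : Word × ℕ => E p.2 := hE.comp snd
  refine .finset_sup (.ite (primrec_isPrefix.comp (fst.comp (snd.comp hentry)) fst) ?_ ?_)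
    (Primrec.list_range.comp Primrec.list_length)
  · exact (ComputableFamily.val_code (RatCode.primrec_posPart.comp (fst.comp hentry))).min
      ((BoxCode.computableFamily_gauge.comp (snd.comp (snd.comp hentry))).natCast_add_one_mul
        (Primrec.list_length.comp fst))
  · exact .zero

theorem approx_mono {x y : Word} (hxy : x <+: y) (P : ProbabilityMeasure Omega) :
    approx E x P ≤ approx E y P := by
  have hlen : x.length ≤ y.length := hxy.length_le
  refine (Finset.sup_mono_fun fun i _ => ?_).trans (Finset.sup_mono fun i hi => ?_)
  · by_cases hi : (E i).2.1 <+: x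
    · rw [if_pos hi, if_pos (hi.trans hxy)]
      gcongr
    · rw [if_neg hi]
      exact zero_le
  · simp only [List.mem_toFinset, List.mem_range] at hi ⊢
    exact hi.trans_le hlen

theorem approx_initialWord_le (hE : Enumerates E t) (ω : Omega) (n : ℕ)
    (P : ProbabilityMeasure Omega) : approx E (initialWord ω n) P ≤ t ω P := by
  refine Finset.sup_le fun i _ => ?_
  split_ifs with hx
  · rcases eq_zero_or_pos ((E i).2.2.gauge P) with h0 | hpos
    · simp [h0]
    · have ht : RatLT (RatCode.val (E i).1) (t ω P) := (hE _ ω P).2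
        ⟨i, rfl, (isPrefix_initialWord_iff.1 hx).2, BoxCode.gauge_pos_iff.1 hpos⟩
      exact min_le_of_left_le (RatCode.posPart_le_of_ratLT ht)
  · exact zero_le

theorem exists_posPart_le_approx {ω : Omega} {P : ProbabilityMeasure Omega} {i : ℕ}
    (hω : ω ∈ cyl (E i).2.1) (hP : P ∈ (E i).2.2.toSet) :
    ∃ n, ((E i).1.posPart.val : ℝ≥0∞) ≤ approx E (initialWord ω n) P := by
  obtain ⟨N, hN⟩ := ENNReal.exists_nat_mul_gt (BoxCode.gauge_pos_iff.2 hP).ne'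
    (ENNReal.coe_ne_top (r := (E i).1.posPart.val))
  let n : ℕ := max (i + 1) (max (E i).2.1.length N)
  have hi : i ∈ (List.range (initialWord ω n).length).toFinset := by
    rw [length_initialWord, List.mem_toFinset, List.mem_range]
    exact Nat.lt_of_succ_le (le_max_left _ _)
  have hx : (E i).2.1 <+: initialWord ω n :=
    isPrefix_initialWord_iff.2 ⟨(le_max_left _ _).trans (le_max_right _ _), hω⟩
  have hNn : (N : ℝ≥0∞) ≤ n + 1 := by
    exact_mod_cast ((le_max_right _ _).trans (le_max_right _ _)).trans n.le_succ
  refine ⟨n, le_trans ?_ (Finset.le_sup hi)⟩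
  rw [if_pos hx, length_initialWord, min_eq_left]
  exact hN.le.trans (by gcongr)

theorem le_iSup_approx (hE : Enumerates E t) (ω : Omega) (P : ProbabilityMeasure Omega) :
    t ω P ≤ ⨆ n, approx E (initialWord ω n) P := by
  refine le_of_forall_lt fun a ha => ?_
  obtain ⟨q, haq, hqt⟩ := NNRatCode.exists_val_between ha
  obtain ⟨i, hi, hω, hP⟩ := (hE _ ω P).1 (RatCode.ratLT_val_natCast_iff.2 hqt)
  obtain ⟨n, hn⟩ := exists_posPart_le_approx hω hP
  rw [hi] at hn
  exact haq.trans_le (hn.trans (le_iSup (fun n => approx E (initialWord ω n) P) n))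

theorem isApproximation_approx (hE : Primrec E) (hEt : Enumerates E t) :
    IsApproximation (approx E) t where
  computable := computableFamily_approx hE
  nil _ := by simp [approx]
  mono P h := approx_mono h P
  iSup_eq ω P := le_antisymm (iSup_le fun n => approx_initialWord_le hEt ω n P)
    (le_iSup_approx hEt ω P)

end Approx

/-! ### The semimeasure of increments -/

/-- The increase of a function of words at the last letter of a word. -/
noncomputable def increment (h : Word → ProbabilityMeasure Omega → ℝ≥0∞) (x : Word)
    (P : ProbabilityMeasure Omega) : ℝ≥0∞ :=
  h x P - h x.dropLast P

namespace IsApproximation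

variable {h : Word → ProbabilityMeasure Omega → ℝ≥0∞}
  {t : Omega → ProbabilityMeasure Omega → ℝ≥0∞}

theorem sum_increment (ht : IsApproximation h t) (ω : Omega) (P : ProbabilityMeasure Omega)
    (n : ℕ) : ∑ k ∈ Finset.range (n + 1), increment h (initialWord ω k) P =
      h (initialWord ω n) P := by
  induction n with
  | zero => simp [increment, initialWord, ht.nil]
  | succ n ih =>
    rw [Finset.sum_range_succ, ih, increment, dropLast_initialWord_succ]
    exact add_tsub_cancel_of_le (ht.mono P
      (isPrefix_initialWord_iff.2 ⟨by simp, isInitial_initialWord ω n⟩))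

theorem tsum_increment (ht : IsApproximation h t) (ω : Omega) (P : ProbabilityMeasure Omega) :
    ∑' n, increment h (initialWord ω n) P = t ω P := by
  rw [ENNReal.tsum_eq_iSup_nat' (Filter.tendsto_add_atTop_nat 1), ← ht.iSup_eq]
  simp only [ht.sum_increment]

theorem isUniformSemimeasure_increment (ht : IsApproximation h t)
    (ht1 : ∀ P : ProbabilityMeasure Omega, ∫⁻ ω, t ω P ∂(P : Measure Omega) ≤ 1) :
    IsUniformSemimeasure fun x P => increment h x P * (P : Measure Omega) (cyl x) where
  lowerSemicomputable := by
    have hdrop : Primrec fun x : Word => x.dropLast :=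
      (Primrec.list_take.comp (Primrec.pred.comp Primrec.list_length) Primrec.id).of_eq
        fun _ => List.dropLast_eq_take.symm
    exact lowerSemicomputableOnWords_iff.2 ((ht.computable.lower.sub
      (ht.computable.upper.comp hdrop)).mul ComputableFamily.measure_cyl.lower)
  tsum_le_one P :=
    calc ∑' x, increment h x P * (P : Measure Omega) (cyl x)
        = ∫⁻ ω, ∑' x : {x : Word // IsInitial x ω}, increment h x P ∂(P : Measure Omega) :=
          (lintegral_tsum_isInitial _ fun x => increment h x P).symm
      _ = ∫⁻ ω, t ω P ∂(P : Measure Omega) := lintegral_congr fun ω => by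
          rw [tsum_isInitial ω fun x => increment h x P, ht.tsum_increment]
      _ ≤ 1 := ht1 P

end IsApproximation

/-! ### Universal tests and a priori probability -/

theorem isUniformSemimeasure_two_pow :
    IsUniformSemimeasure fun x _ => (2⁻¹ : ℝ≥0∞) ^ (Encodable.encode x + 1) where
  lowerSemicomputable := by
    have hpow : Primrec₂ fun a b : ℕ => a ^ b := Primrec₂.unpaired'.1 Nat.Primrec.pow
    have hcode : Primrec fun x : Word => (1, 2 ^ (Encodable.encode x + 1) - 1) :=
      (Primrec.const 1).pair (Primrec.pred.comp (hpow.comp (Primrec.const 2)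
        (Primrec.succ.comp Primrec.encode)))
    have hval (k : ℕ) : (NNRatCode.val (1, 2 ^ k - 1) : ℝ≥0∞) = 2⁻¹ ^ k := by
      have h : ((2 ^ k - 1 : ℕ) : ℝ≥0) + 1 = 2 ^ k := by
        exact_mod_cast Nat.sub_add_cancel (Nat.one_le_two_pow)
      rw [NNRatCode.val_one_left, h, ENNReal.coe_inv (by positivity), ENNReal.coe_pow,
        ENNReal.inv_pow, ENNReal.coe_ofNat]
    simpa only [hval] using
      lowerSemicomputableOnWords_iff.2 (ComputableFamily.val_code hcode).lower
  tsum_le_one _ := by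
    calc ∑' x : Word, (2⁻¹ : ℝ≥0∞) ^ (Encodable.encode x + 1)
        ≤ ∑' n : ℕ, (2⁻¹ : ℝ≥0∞) ^ (n + 1) :=
          ENNReal.tsum_comp_le_tsum_of_injective Encodable.encode_injective _
      _ = 1 := by
          rw [ENNReal.tsum_geometric_add_one, ENNReal.one_sub_inv_two, inv_inv]
          exact ENNReal.inv_mul_cancel (by simp) (by simp)

theorem IsAprioriProbability.ne_zero {m : Word → ProbabilityMeasure Omega → ℝ≥0∞}
    (hm : IsAprioriProbability m) (x : Word) (P : ProbabilityMeasure Omega) : m x P ≠ 0 := by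
  obtain ⟨c, hc⟩ := hm.maximal _ isUniformSemimeasure_two_pow
  intro h0
  simpa [h0] using hc x P

theorem IsAprioriProbability.test_le_initialSum
    {m : Word → ProbabilityMeasure Omega → ℝ≥0∞} (hm : IsAprioriProbability m)
    {t : Omega → ProbabilityMeasure Omega → ℝ≥0∞} (ht : IsUniformTest t) :
    ∃ c : ℝ≥0, ∀ ω P, t ω P ≤ c * initialSum m ω P := by
  obtain ⟨E, hE, hEt⟩ := ht.lowerSemicomputable.exists_enumerates
  have happrox : IsApproximation (approx E) t := isApproximation_approx hE hEt
  obtain ⟨c, hc⟩ := hm.maximal _ (happrox.isUniformSemimeasure_increment ht.lintegral_le_one)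
  have hincr (x : Word) (P : ProbabilityMeasure Omega) :
      increment (approx E) x P ≤ (c + 1 : ℝ≥0) * (m x P / (P : Measure Omega) (cyl x)) := by
    have h0 : ((c + 1 : ℝ≥0) : ℝ≥0∞) * m x P ≠ 0 := mul_ne_zero (by simp) (hm.ne_zero x P)
    rw [← mul_div_assoc, ENNReal.le_div_iff_mul_le (.inr h0) (.inl (measure_ne_top _ _))]
    exact (hc x P).trans (by gcongr; exact le_self_add)
  refine ⟨c + 1, fun ω P => ?_⟩
  rw [← happrox.tsum_increment, initialSum_eq_tsum, ← ENNReal.tsum_mul_left]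
  exact ENNReal.tsum_le_tsum fun n => hincr _ P

end CantorRandomness

theorem mainTheorem4
    (t : (ℕ → Bool) → MeasureTheory.ProbabilityMeasure (ℕ → Bool) → ENNReal)
    (ht : CantorRandomness.IsUniversalUniformTest t)
    (m : List Bool → MeasureTheory.ProbabilityMeasure (ℕ → Bool) → ENNReal)
    (hm : CantorRandomness.IsAprioriProbability m) :
    CantorRandomness.EqUpToFactor t (CantorRandomness.initialSum m) :=
  ⟨hm.test_le_initialSum ht.isUniformTest,
    ht.maximal _ hm.isUniformSemimeasure.isUniformTest_initialSum⟩
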